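/- Let $d\ge 2$, $\mathbb S_{d-1}=\{\eta\in\mathbb R^d:\|\eta\|_2=1\}$, let $d(\eta,\zeta)=\arccos\langle\eta,\zeta\rangle$ be the geodesic distance on $\mathbb S_{d-1}$, and fix $0<H\le 1/2$ and $0<\alpha<1/2$. For $O\in\mathbb S_{d-1}$ let $$K_O(\eta,\zeta)=\tfrac12\bigl(d(\eta,O)^{2H}+d(\zeta,O)^{2H}-d(\eta,\zeta)^{2H}\bigr),\qquad \eta,\zeta\in\mathbb S_{d-1},$$ be the covariance function of spherical fractional Brownian motion (SFBM) with Hurst parameter $H$, that is, of the continuous centred Gaussian process $(S_H(\eta))_{\eta\in\mathbb S_{d-1}}$ with $\mathbb E[S_H(\eta)S_H(\zeta)]=K_O(\eta,\zeta)$. Then $K_O$ is positive semi-definite; let $\mathbb H=\mathbb H_O$ be the RKHS of SFBM, i.e. the reproducing kernel Hilbert space of real functions on $\mathbb S_{d-1}$ with reproducing kernel $K_O$. For $\delta>0$ put $$f_{\delta,\alpha}(\eta)=16^{H+\alpha}\bigl[G(1)-G(\langle\eta,O\rangle)\bigr]\delta^{-(H+\alpha)},\qquad G(t)=2^{h}-(1-t)^{h}+(1+t)^{h},\quad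 h=\tfrac{H+\alpha}{2}.$$ There is a constant $c>0$ depending only on $\alpha$, $H$ and $d$ such that, for every $O\in\mathbb S_{d-1}$ and every $\delta>0$: the function $f_{\delta,\alpha}$ belongs to $\mathbb H$; moreover (a) $\delta^{2(H+\alpha)}\|f_{\delta,\alpha}\|_{\mathbb H}^2\le c$; and (b) $f_{\delta,\alpha}(\eta)\ge 1$ for all $\eta\in\mathbb S_{d-1}$ with $d(O,\eta)>\delta$. -/

import Mathlib

open MeasureTheory ProbabilityTheory

noncomputable section

/-- The unit sphere of `ℝ^d` with its Euclidean norm. -/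
abbrev UnitSphere (d : ℕ) : Type := Metric.sphere (0 : EuclideanSpace ℝ (Fin d)) 1

/-- The geodesic distance on the unit sphere. -/
def geodesicDist {d : ℕ} (η ζ : UnitSphere d) : ℝ :=
  Real.arccos (inner ℝ (η : EuclideanSpace ℝ (Fin d)) (ζ : EuclideanSpace ℝ (Fin d)))

/-- The closed geodesic ball of radius `δ` around `η`. -/
def geodesicBall {d : ℕ} (η : UnitSphere d) (δ : ℝ) : Set (UnitSphere d) :=
  {ζ | geodesicDist η ζ ≤ δ}

/-- The covariance function of spherical fractional Brownian motion with Hurst parameter `H`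
and base point `O`. -/
def sfbmCov {d : ℕ} (H : ℝ) (O η ζ : UnitSphere d) : ℝ :=
  (1 / 2) * (geodesicDist η O ^ (2 * H) + geodesicDist ζ O ^ (2 * H)
    - geodesicDist η ζ ^ (2 * H))

/-- A real number acting on `ℝ` by multiplication; Mathlib's reproducing kernels are matrices
of continuous linear maps, so a real-valued kernel is a matrix of such multiplications. -/
def realKernel {X : Type*} (K : X → X → ℝ) : Matrix X X (ℝ →L[ℝ] ℝ) :=
  Matrix.of fun x y => K x y • ContinuousLinearMap.id ℝ ℝ

/-- The covariance of spherical fractional Brownian motion, as a reproducing kernel. -/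
def sfbmKernel {d : ℕ} (H : ℝ) (O : UnitSphere d) :
    Matrix (UnitSphere d) (UnitSphere d) (ℝ →L[ℝ] ℝ) :=
  realKernel (sfbmCov H O)

/-- Spherical fractional Brownian motion: a continuous centred Gaussian process on the sphere
with covariance `sfbmCov H O`. -/
structure IsSFBM {d : ℕ} {Ω : Type*} [MeasurableSpace Ω] (P : Measure Ω) (H : ℝ)
    (O : UnitSphere d) (S : UnitSphere d → Ω → ℝ) : Prop where
  gaussian : IsGaussianProcess S P
  centred : ∀ η, ∫ ω, S η ω ∂P = 0
  cov : ∀ η ζ, ∫ ω, S η ω * S ζ ω ∂P = sfbmCov H O η ζ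
  continuous_paths : ∀ ω, Continuous fun η => S η ω

/-- The covariance kernel of a centred process; the RKHS of the process is the RKHS with this
reproducing kernel. -/
def covarianceKernel {T Ω : Type*} [MeasurableSpace Ω] (P : Measure Ω) (S : T → Ω → ℝ) :
    Matrix T T (ℝ →L[ℝ] ℝ) :=
  realKernel fun s t => ∫ ω, S s ω * S t ω ∂P

/-- The RKHS of spherical fractional Brownian motion is the one with kernel `sfbmKernel`. -/
theorem IsSFBM.covarianceKernel_eq {d : ℕ} {Ω : Type*} [MeasurableSpace Ω] {P : Measure Ω}
    {H : ℝ} {O : UnitSphere d} {S : UnitSphere d → Ω → ℝ} (hS : IsSFBM P H O S) :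
    covarianceKernel P S = sfbmKernel H O := by
  unfold covarianceKernel sfbmKernel
  congr 1
  funext η ζ
  exact hS.cov η ζ

/-- `G^{(h)}(t) = 2^h - (1 - t)^h + (1 + t)^h`, used for `t ∈ [-1, 1]` only. -/
def auxG (h t : ℝ) : ℝ := (2 : ℝ) ^ h - (1 - t) ^ h + (1 + t) ^ h

/-- The function `f_{δ,α}` on the sphere. -/
def fDelta {d : ℕ} (H α : ℝ) (O : UnitSphere d) (δ : ℝ) (η : UnitSphere d) : ℝ :=
  (16 : ℝ) ^ (H + α) *
    (auxG ((H + α) / 2) 1 - auxG ((H + α) / 2)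
      (inner ℝ (η : EuclideanSpace ℝ (Fin d)) (O : EuclideanSpace ℝ (Fin d)))) *
    δ ^ (-(H + α))

end

/-! Everything is expanded in powers of the inner product. With p = 2H, `exists_hasSum_arccos_rpow`
writes arccos^p as ∑ c_n (1 - t^n) with c_n ≥ 0. Since ⟨η, ζ⟩^n is the inner product of n-th tensor
powers, twice the covariance form is ∑ c_n ‖w_n‖², where w_n = ∑ a_η (O^⊗n - η^⊗n); hence positive
semi-definiteness. Pairing w_n with the unit vector O^⊗n gives |∑ a_η (1 - ⟨η, O⟩^n)| ≤ ‖w_n‖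
(`sq_sum_le_sum_sum`).

The zonal function G(1) - G(t) is ∑ b_k (1 - t^(2k+1)) with 0 ≤ b_k ≲ k^(-1-(H+α)/2)
(`exists_hasSum_auxG`), while c_(2k+1) ≳ k^(-1-H). Thus ∑ b_k² / c_(2k+1) ≲ ∑ k^(-1-α) < ∞, and
weighted Cauchy-Schwarz bounds the functional a ↦ ∑ a_η (G(1) - G(⟨η, O⟩)) by the covariance form
(`exists_sq_sum_auxG_le`). By Riesz representation this is membership in the RKHS with a norm bound
(`RKHS.exists_eq_of_sq_le`).

The delicate point is the lower bound on c: the derivative of -arccos^p is p · arccos^(p-1) · (1 -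
t²)^(-1/2), a product of nonnegative series, and a Tauberian estimate (`exists_le_sum_range`)
controls the partial sums of the first factor. -/

lemma HasSum.congr_terms {ι : Type*} {f g : ι → ℝ} {s : ℝ} (h : HasSum f s)
    (hg : ∀ i, g i = f i) : HasSum g s := by
  rwa [funext hg]

/-! ### Power series with nonnegative coefficients -/

/-- `f` is the sum on `(-1, 1)` of the power series with nonnegative coefficients `a`. -/
def IsNonnegSeries (a : ℕ → ℝ) (f : ℝ → ℝ) : Prop :=
  (∀ n, 0 ≤ a n) ∧ ∀ t : ℝ, |t| < 1 → HasSum (fun n => a n * t ^ n) (f t)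

/-- The coefficients of `(1 - x) ^ (-q)`. -/
noncomputable def negBinomCoeff (q : ℝ) (n : ℕ) : ℝ := ∏ i ∈ Finset.range n, (q + i) / (i + 1)

lemma negBinomCoeff_succ (q : ℝ) (n : ℕ) :
    negBinomCoeff q (n + 1) = negBinomCoeff q n * ((q + n) / (n + 1)) := by
  rw [negBinomCoeff, Finset.prod_range_succ, negBinomCoeff]

lemma ringChoose_eq_negBinomCoeff (q : ℝ) (n : ℕ) :
    Ring.choose (q + n - 1) n = negBinomCoeff q n := by
  rw [← Ring.multichoose_eq]
  have h := Ring.factorial_nsmul_multichoose_eq_ascPochhammer q n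
  rw [Polynomial.ascPochhammer_smeval_eq_eval, nsmul_eq_mul] at h
  have key : (ascPochhammer ℝ n).eval q = n.factorial * negBinomCoeff q n := by
    clear h
    induction n with
    | zero => simp [negBinomCoeff]
    | succ n ih =>
      rw [ascPochhammer_succ_eval, ih, negBinomCoeff_succ, Nat.factorial_succ]
      push_cast
      field_simp
  rw [key] at h
  exact mul_left_cancel₀ (by positivity) h

lemma hasSum_negBinomCoeff (q : ℝ) {x : ℝ} (hx : |x| < 1) :
    HasSum (fun n => negBinomCoeff q n * x ^ n) ((1 - x) ^ (-q)) := by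
  have h := (Real.one_div_one_sub_rpow_hasFPowerSeriesOnBall_zero q).hasSum (y := x)
    (by simpa [enorm_eq_nnnorm] using! hx)
  simp only [FormalMultilinearSeries.ofScalars_apply_eq, ringChoose_eq_negBinomCoeff,
    zero_add, smul_eq_mul] at h
  rw [Real.rpow_neg (by linarith [(abs_lt.1 hx).2]), ← one_div]
  exact h

lemma negBinomCoeff_nonneg {q : ℝ} (hq : 0 ≤ q) (n : ℕ) : 0 ≤ negBinomCoeff q n :=
  Finset.prod_nonneg fun _ _ => by positivity

lemma isNonnegSeries_one_sub_rpow {q : ℝ} (hq : 0 ≤ q) :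
    IsNonnegSeries (negBinomCoeff q) fun x => (1 - x) ^ (-q) :=
  ⟨negBinomCoeff_nonneg hq, fun _ ht => hasSum_negBinomCoeff q ht⟩

namespace IsNonnegSeries

variable {a b : ℕ → ℝ} {f g : ℝ → ℝ}

lemma summable_abs (ha : IsNonnegSeries a f) {t : ℝ} (ht : |t| < 1) :
    Summable fun n => |a n * t ^ n| := by
  have := (ha.2 |t| (by rwa [abs_abs])).summable
  refine this.congr fun n => ?_
  rw [abs_mul, abs_pow, abs_of_nonneg (ha.1 n)]

lemma nonneg (ha : IsNonnegSeries a f) {t : ℝ} (h0 : 0 ≤ t) (ht : |t| < 1) : 0 ≤ f t :=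
  (ha.2 t ht).nonneg fun n => mul_nonneg (ha.1 n) (pow_nonneg h0 n)

lemma abs_le (ha : IsNonnegSeries a f) {t : ℝ} (ht : |t| < 1) : |f t| ≤ f |t| := by
  have h := (ha.2 |t| (by rwa [abs_abs]))
  rw [← Real.norm_eq_abs, ← (ha.2 t ht).tsum_eq]
  refine tsum_of_norm_bounded h fun n => ?_
  rw [Real.norm_eq_abs, abs_mul, abs_pow, abs_of_nonneg (ha.1 n)]

lemma const_mul (ha : IsNonnegSeries a f) {c : ℝ} (hc : 0 ≤ c) :
    IsNonnegSeries (fun n => c * a n) fun t => c * f t :=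
  ⟨fun n => mul_nonneg hc (ha.1 n), fun t ht => by
    simpa only [mul_assoc] using (ha.2 t ht).mul_left c⟩

lemma congr (ha : IsNonnegSeries a f) (h : ∀ t, |t| < 1 → f t = g t) : IsNonnegSeries a g :=
  ⟨ha.1, fun t ht => h t ht ▸ ha.2 t ht⟩

lemma one : IsNonnegSeries (fun n => if n = 0 then 1 else 0) fun _ => 1 := by
  refine ⟨fun n => by positivity, fun t _ => ?_⟩
  convert hasSum_ite_eq 0 (1 : ℝ) using 2 with n
  split_ifs with h <;> simp [h]

lemma mul (ha : IsNonnegSeries a f) (hb : IsNonnegSeries b g) :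
    IsNonnegSeries (fun n => ∑ k ∈ Finset.range (n + 1), a k * b (n - k)) fun t => f t * g t := by
  refine ⟨fun n => Finset.sum_nonneg fun k _ => mul_nonneg (ha.1 _) (hb.1 _), fun t ht => ?_⟩
  have h : HasSum (fun n => ∑ k ∈ Finset.range (n + 1), a k * t ^ k * (b (n - k) * t ^ (n - k)))
      ((∑' n, a n * t ^ n) * ∑' n, b n * t ^ n) :=
    hasSum_sum_range_mul_of_summable_norm (f := fun n => a n * t ^ n) (g := fun n => b n * t ^ n)
      (by simpa only [Real.norm_eq_abs] using ha.summable_abs ht)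
      (by simpa only [Real.norm_eq_abs] using hb.summable_abs ht)
  rw [(ha.2 t ht).tsum_eq, (hb.2 t ht).tsum_eq] at h
  refine h.congr_terms fun n => ?_
  rw [Finset.sum_mul]
  refine Finset.sum_congr rfl fun k hk => ?_
  have hkn : t ^ n = t ^ k * t ^ (n - k) := by
    rw [← pow_add, Nat.add_sub_cancel' (Finset.mem_range_succ_iff.1 hk)]
  rw [hkn]
  ring

lemma exists_pow (hb : IsNonnegSeries b g) (j : ℕ) : ∃ c, IsNonnegSeries c fun t => g t ^ j := by
  induction j with
  | zero => exact ⟨_, one.congr fun t _ => by simp⟩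
  | succ j ih =>
    obtain ⟨c, hc⟩ := ih
    exact ⟨_, (hc.mul hb).congr fun t _ => by simp [pow_succ]⟩

/-- Expand every power of g and interchange the double sum. Nonnegativity reduces absolute
summability at t to convergence at |t|, so a bound on g over [0, 1) is enough. -/
lemma exists_comp (ha : IsNonnegSeries a f) (hb : IsNonnegSeries b g)
    (hg : ∀ t, 0 ≤ t → t < 1 → g t < 1) : ∃ c, IsNonnegSeries c fun t => f (g t) := by
  choose B hB using fun j => hb.exists_pow j
  have hsum : ∀ t : ℝ, |t| < 1 → Summable fun x : ℕ × ℕ => |a x.1 * (B x.1 x.2 * t ^ x.2)| := by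
    intro t ht
    have ht' : |(|t|)| < 1 := by rwa [abs_abs]
    have hgt : |g (|t|)| < 1 := by
      rw [abs_of_nonneg (hb.nonneg (abs_nonneg t) ht')]
      exact hg _ (abs_nonneg t) ht
    have h1 : ∀ j, HasSum (fun m => |a j * (B j m * t ^ m)|) (a j * g (|t|) ^ j) := by
      intro j
      have := ((hB j).2 _ ht').mul_left (a j)
      refine this.congr_terms fun m => ?_
      rw [abs_mul, abs_mul, abs_pow, abs_of_nonneg (ha.1 j), abs_of_nonneg ((hB j).1 m)]
    rw [summable_prod_of_nonneg fun _ => abs_nonneg _]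
    refine ⟨fun j => (h1 j).summable, ?_⟩
    simp only [(h1 _).tsum_eq]
    exact (ha.2 _ hgt).summable
  have habs : ∀ t : ℝ, |t| < 1 → |g t| < 1 := fun t ht =>
    (hb.abs_le ht).trans_lt (hg _ (abs_nonneg t) ht)
  refine ⟨fun m => ∑' j, a j * B j m, fun m => tsum_nonneg fun j =>
    mul_nonneg (ha.1 j) ((hB j).1 m), fun t ht => ?_⟩
  have hs := (hsum t ht).of_abs
  have h1 := hs.hasSum.prod_fiberwise fun j => ((hB j).2 t ht).mul_left (a j)
  have h2 := (ha.2 _ (habs t ht)).unique h1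
  have h3 := (Equiv.prodComm ℕ ℕ).hasSum_iff.2 hs.hasSum
  have h4 := h3.prod_fiberwise fun m => (h3.summable.prod_factor m).hasSum
  rw [← h2] at h4
  refine h4.congr_terms fun m => ?_
  rw [← tsum_mul_right]
  simp [mul_assoc]

/-- Termwise integration. -/
lemma integral {F : ℝ → ℝ} (ha : IsNonnegSeries a f)
    (hF : ∀ t, |t| < 1 → HasDerivAt F (f t) t) :
    IsNonnegSeries (fun n => if n = 0 then 0 else a (n - 1) / n) fun t => F t - F 0 := by
  refine ⟨fun n => ?_, ?_⟩
  · dsimp only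
    split_ifs
    · exact le_rfl
    · exact div_nonneg (ha.1 _) (Nat.cast_nonneg _)
  set c : ℕ → ℝ := fun n => a n / (n + 1)
  have hs : ∀ t : ℝ, |t| < 1 → Summable fun n => c n * t ^ (n + 1) := by
    intro t ht
    refine ((ha.summable_abs ht)).of_norm_bounded fun n => ?_
    rw [Real.norm_eq_abs, pow_succ, ← mul_assoc, abs_mul, abs_mul, abs_mul]
    have h1 : |c n| ≤ |a n| := by
      rw [abs_div]
      refine div_le_self (abs_nonneg _) ?_
      rw [abs_of_nonneg (by positivity)]
      simp
    calc |c n| * |t ^ n| * |t| ≤ |a n| * |t ^ n| * 1 := by gcongr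
      _ = _ := mul_one _
  have hd : ∀ t : ℝ, |t| < 1 → HasDerivAt (fun t => ∑' n, c n * t ^ (n + 1)) (f t) t := by
    intro t ht
    -- On the ball of radius r the differentiated terms have the summable majorant a n * r ^ n.
    obtain ⟨r, htr, hr1⟩ := exists_between ht
    have hr0 : 0 ≤ r := (abs_nonneg t).trans htr.le
    have hr : |r| < 1 := by rwa [abs_of_nonneg hr0]
    have := hasDerivAt_tsum_of_isPreconnected (u := fun n => a n * r ^ n)
      (g := fun n t => c n * t ^ (n + 1)) (g' := fun n t => a n * t ^ n)
      (ha.2 r hr).summable (t := Metric.ball 0 r) Metric.isOpen_ball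
      (convex_ball _ _).isPreconnected (y₀ := t) (y := t) ?_ ?_ (by simpa using htr) (hs t ht)
      (by simpa using htr)
    · rwa [(ha.2 t ht).tsum_eq] at this
    · intro n y _
      have := (hasDerivAt_pow (n + 1) y).const_mul (c n)
      refine this.congr_deriv ?_
      simp only [c, Nat.add_sub_cancel]
      push_cast
      field_simp
    · intro n y hy
      rw [Real.norm_eq_abs, abs_mul, abs_pow, abs_of_nonneg (ha.1 n)]
      have : |y| ≤ r := by simpa using (mem_ball_zero_iff.1 hy).le
      have := ha.1 n
      gcongr
  intro t ht
  have heq : F t - F 0 = ∑' n, c n * t ^ (n + 1) := by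
    have := (convex_ball (0 : ℝ) 1).is_const_of_fderivWithin_eq_zero (𝕜 := ℝ)
      (f := fun t => F t - ∑' n, c n * t ^ (n + 1)) (x := t) (y := 0) ?_ ?_ (by simpa using ht)
      (by simp)
    · simp at this
      linarith
    · intro y hy
      have hy : |y| < 1 := by simpa using hy
      exact ((hF y hy).sub (hd y hy)).differentiableAt.differentiableWithinAt
    · intro y hy
      have hy' : |y| < 1 := by simpa using hy
      have := ((hF y hy').fun_sub (hd y hy'))
      rw [sub_self] at this
      rw [fderivWithin_of_isOpen Metric.isOpen_ball hy]
      ext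
      simpa using this.deriv
  dsimp only
  rw [heq]
  refine (hasSum_nat_add_iff' 1).1 ?_
  simpa [c] using (hs t ht).hasSum

/-- A nonnegative power series that stays bounded on `[0, 1)` is summable at `1`. -/
lemma summable_of_le (ha : IsNonnegSeries a f) {C : ℝ} (hC : ∀ t, 0 ≤ t → t < 1 → f t ≤ C) :
    Summable a := by
  refine summable_of_sum_range_le (c := C) ha.1 fun N => ?_
  have hcont : Continuous fun t : ℝ => ∑ n ∈ Finset.range N, a n * t ^ n := by fun_prop
  have hlim := hcont.continuousWithinAt (s := Set.Iio 1) (x := (1 : ℝ))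
  simp only [ContinuousWithinAt, one_pow, mul_one] at hlim
  refine le_of_tendsto hlim ?_
  filter_upwards [Ioo_mem_nhdsLT (show (0 : ℝ) < 1 by norm_num)] with t ht
  refine le_trans ?_ (hC t ht.1.le ht.2)
  exact sum_le_hasSum _ (fun n _ => mul_nonneg (ha.1 n) (pow_nonneg ht.1.le n))
    (ha.2 t (by rw [abs_of_pos ht.1]; exact ht.2))

end IsNonnegSeries

/-! ### Behaviour at the endpoints and a Tauberian lower bound -/

/-- An absolutely summable power series represents a continuous function up to the endpoints. -/
lemma hasSum_pow_Icc {a : ℕ → ℝ} {f : ℝ → ℝ} (ha : Summable fun n => |a n|)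
    (hf : ContinuousOn f (Set.Icc (-1) 1))
    (h : ∀ t : ℝ, |t| < 1 → HasSum (fun n => a n * t ^ n) (f t)) {t : ℝ}
    (ht : t ∈ Set.Icc (-1 : ℝ) 1) : HasSum (fun n => a n * t ^ n) (f t) := by
  have hb : ∀ n, ∀ t ∈ Set.Icc (-1 : ℝ) 1, ‖a n * t ^ n‖ ≤ |a n| := by
    intro n t ht
    rw [Real.norm_eq_abs, abs_mul, abs_pow]
    exact mul_le_of_le_one_right (abs_nonneg _) (pow_le_one₀ (abs_nonneg _) (abs_le.2 ht))
  have hc : ContinuousOn (fun t : ℝ => ∑' n, a n * t ^ n) (Set.Icc (-1) 1) :=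
    continuousOn_tsum (fun n => by fun_prop) ha hb
  have heq : Set.EqOn (fun t : ℝ => ∑' n, a n * t ^ n) f (Set.Ioo (-1) 1) :=
    fun s hs => (h s (abs_lt.2 hs)).tsum_eq
  have := heq.of_subset_closure hc hf Set.Ioo_subset_Icc_self
    (by rw [closure_Ioo (by norm_num)])
  rw [← this ht]
  exact (ha.of_norm_bounded fun n => hb n t ht).hasSum

/-- Partial sums of a nonnegative power series growing like `(1 - r) ^ (-β)` at `1` grow at least
like the power `β` of their length. -/
lemma exists_le_sum_range {a : ℕ → ℝ} {A : ℝ → ℝ} {c C β : ℝ} (hc : 0 < c) (hβ : 0 ≤ β)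
    (ha : ∀ n, 0 ≤ a n) (hA : ∀ r : ℝ, 0 ≤ r → r < 1 → HasSum (fun n => a n * r ^ n) (A r))
    (hlow : ∀ r : ℝ, 0 ≤ r → r < 1 → c * (1 - r) ^ (-β) ≤ A r)
    (hup : ∀ r : ℝ, 0 ≤ r → r < 1 → A r ≤ C * (1 - r) ^ (-β)) :
    ∃ κ > 0, ∀ k : ℕ, κ * ((k : ℝ) + 1) ^ β ≤ ∑ j ∈ Finset.range (k + 1), a j := by
  have hC : 0 < C := by
    have h1 := hlow 0 le_rfl (by norm_num)
    have h2 := hup 0 le_rfl (by norm_num)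
    simp at h1 h2
    linarith
  -- M is chosen so large that, at distance ε = M / (k + 1) from 1, the tail beyond k takes at most
  -- half of the lower bound.
  obtain ⟨M, hM1, hM⟩ : ∃ M : ℝ, 1 ≤ M ∧ C * Real.exp (-(M / 2)) ≤ c * 2 ^ (-β) / 2 := by
    have h1 : Filter.Tendsto (fun M : ℝ => C * Real.exp (-(M / 2))) Filter.atTop (nhds (C * 0)) := by
      refine Filter.Tendsto.const_mul _ (Real.tendsto_exp_neg_atTop_nhds_zero.comp ?_)
      exact Filter.tendsto_id.atTop_div_const (by norm_num)
    rw [mul_zero] at h1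
    have h2 : (0 : ℝ) < c * 2 ^ (-β) / 2 := by positivity
    obtain ⟨M, h3, h4⟩ := ((h1.eventually (gt_mem_nhds h2)).and
      (Filter.eventually_ge_atTop 1)).exists
    exact ⟨M, h4, h3.le⟩
  have hM0 : 0 < M := by linarith
  refine ⟨c * 2 ^ (-β) / 2 * M ^ (-β), by positivity, fun k => ?_⟩
  have hk : (0 : ℝ) < k + 1 := by positivity
  have h2β : (2 : ℝ) ^ (-β) ≤ 1 := Real.rpow_le_one_of_one_le_of_nonpos (by norm_num) (by linarith)
  have hrew : M ^ (-β) * ((k : ℝ) + 1) ^ β = (((k : ℝ) + 1) / M) ^ β := by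
    rw [Real.div_rpow hk.le hM0.le, Real.rpow_neg hM0.le]
    field_simp
  rw [mul_assoc, hrew]
  -- For small k the term a 0 ≥ c already suffices.
  rcases le_or_gt ((k : ℝ) + 1) M with hkM | hkM
  · have h0 : c ≤ a 0 := by
      have h1 := hlow 0 le_rfl (by norm_num)
      have h2 := (hA 0 le_rfl (by norm_num)).unique (hasSum_single (f := fun n => a n * 0 ^ n) 0
        fun n hn => by simp [hn])
      simp at h1 h2
      linarith
    have h1 : a 0 ≤ ∑ j ∈ Finset.range (k + 1), a j :=
      Finset.single_le_sum (fun j _ => ha j) (by simp)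
    have h3 : (((k : ℝ) + 1) / M) ^ β ≤ 1 :=
      Real.rpow_le_one (by positivity) ((div_le_one hM0).2 hkM) hβ
    calc c * 2 ^ (-β) / 2 * (((k : ℝ) + 1) / M) ^ β ≤ c * 1 / 2 * 1 := by gcongr
      _ ≤ _ := by linarith
  · set ε := M / ((k : ℝ) + 1) with hε
    have hε0 : 0 < ε := by positivity
    have hε1 : ε < 1 := (div_lt_one hk).2 hkM
    have hk1 : (1 : ℝ) ≤ k := by
      have : (1 : ℝ) < (k : ℝ) + 1 := by linarith
      have : 0 < k := by
        rw [← Nat.cast_pos (α := ℝ)]; linarith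
      exact_mod_cast this
    set ρ := 1 - ε with hρ
    have hρ0 : 0 < ρ := by linarith
    have hρ1 : ρ < 1 := by linarith
    -- Splitting at k gives A(ρ²) ≤ ∑_{j ≤ k} a_j + ρ^k A(ρ): in the tail, ρ^(2j) ≤ ρ^k ρ^j.
    have hs1 := hA (ρ ^ 2) (by positivity) (by nlinarith)
    have hs2 := ((hA ρ hρ0.le hρ1).mul_left (ρ ^ k)).add
      (hasSum_sum_of_ne_finset_zero (s := Finset.range (k + 1))
        (f := fun j => if j ∈ Finset.range (k + 1) then a j else 0)
        fun j hj => by simp only [hj, if_false])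
    have hle := hasSum_le (fun j => ?_) hs1 hs2
    · rw [Finset.sum_ite_mem, Finset.inter_self] at hle
      have h1 : c * (2 * ε) ^ (-β) ≤ A (ρ ^ 2) := by
        refine le_trans ?_ (hlow (ρ ^ 2) (by positivity) (by nlinarith))
        refine mul_le_mul_of_nonneg_left ?_ hc.le
        refine Real.rpow_le_rpow_of_nonpos (by nlinarith) (by nlinarith) (by linarith)
      have h2 := hup ρ hρ0.le hρ1
      rw [show 1 - ρ = ε by simp [hρ]] at h2
      have h3 : ρ ^ k ≤ Real.exp (-(M / 2)) := by
        have : ρ ≤ Real.exp (-ε) := by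
          have := Real.add_one_le_exp (-ε); linarith
        calc ρ ^ k ≤ Real.exp (-ε) ^ k := by gcongr
          _ = Real.exp (-(k * ε)) := by rw [← Real.exp_nat_mul, mul_neg]
          _ ≤ _ := by
            refine Real.exp_le_exp.2 (neg_le_neg ?_)
            rw [hε, mul_div_assoc', div_le_div_iff₀ (by norm_num) hk]
            nlinarith
      have h4 : ε ^ (-β) = (((k : ℝ) + 1) / M) ^ β := by
        rw [Real.rpow_neg hε0.le, ← Real.inv_rpow hε0.le, hε, inv_div]
      have h5 : ρ ^ k * A ρ ≤ c * 2 ^ (-β) / 2 * ε ^ (-β) := by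
        have : 0 < ε ^ (-β) := by positivity
        calc ρ ^ k * A ρ ≤ ρ ^ k * (C * ε ^ (-β)) := by gcongr
          _ ≤ Real.exp (-(M / 2)) * (C * ε ^ (-β)) := by gcongr
          _ = C * Real.exp (-(M / 2)) * ε ^ (-β) := by ring
          _ ≤ _ := by gcongr
      rw [Real.mul_rpow (by norm_num) hε0.le] at h1
      rw [← h4]
      linarith
    · have hj0 := ha j
      have hp : 0 ≤ ρ ^ k * (a j * ρ ^ j) := by positivity
      simp only [Finset.mem_range]
      split_ifs with hj
      · have : a j * (ρ ^ 2) ^ j ≤ a j * 1 := by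
          gcongr
          exact pow_le_one₀ (by positivity) (by nlinarith)
        linarith
      · have : ρ ^ j ≤ ρ ^ k := pow_le_pow_of_le_one hρ0.le hρ1.le (by omega)
        calc a j * (ρ ^ 2) ^ j = ρ ^ j * (a j * ρ ^ j) := by rw [← pow_mul, two_mul, pow_add]; ring
          _ ≤ ρ ^ k * (a j * ρ ^ j) := by gcongr
          _ = _ := by rw [add_zero]

/-! ### The expansion of powers of arccos -/

/-- The coefficients of `(1 - t ^ 2) ^ (-1 / 2)`. -/
noncomputable def invSqrtCoeff (n : ℕ) : ℝ := if Even n then negBinomCoeff (1 / 2) (n / 2) else 0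

lemma isNonnegSeries_inv_sqrt :
    IsNonnegSeries invSqrtCoeff fun t => (1 - t ^ 2) ^ (-(1 / 2) : ℝ) := by
  refine ⟨fun n => ?_, fun t ht => ?_⟩
  · unfold invSqrtCoeff
    split_ifs
    · exact negBinomCoeff_nonneg (by norm_num) _
    · exact le_rfl
  · have ht2 : |t ^ 2| < 1 := by
      rw [abs_pow]
      exact pow_lt_one₀ (abs_nonneg t) ht (by norm_num)
    have h1 : HasSum (fun k => invSqrtCoeff (2 * k) * t ^ (2 * k))
        ((1 - t ^ 2) ^ (-(1 / 2) : ℝ)) :=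
      (hasSum_negBinomCoeff (1 / 2) ht2).congr_terms fun k => by
        simp [invSqrtCoeff, pow_mul]
    have h2 : HasSum (fun k => invSqrtCoeff (2 * k + 1) * t ^ (2 * k + 1)) 0 :=
      hasSum_zero.congr_terms fun k => by simp [invSqrtCoeff]
    have h3 := HasSum.even_add_odd (f := fun n => invSqrtCoeff n * t ^ n) h1 h2
    rwa [add_zero] at h3

lemma inv_sqrt_eq_rpow (t : ℝ) (ht : |t| < 1) : 1 / √(1 - t ^ 2) = (1 - t ^ 2) ^ (-(1 / 2) : ℝ) := by
  have : 0 ≤ 1 - t ^ 2 := by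
    have := (sq_lt_one_iff_abs_lt_one t).2 ht
    linarith
  rw [Real.rpow_neg this, Real.sqrt_eq_rpow, one_div]

/-- The factor 2 / π keeps the function below 1 on [0, 1), as substitution into (1 - x)^(-q)
requires. -/
lemma exists_isNonnegSeries_arcsin : ∃ a, IsNonnegSeries a fun t => 2 / Real.pi * Real.arcsin t := by
  have h := isNonnegSeries_inv_sqrt.integral (F := Real.arcsin) fun t ht => by
    have ht' := abs_lt.1 ht
    rw [← inv_sqrt_eq_rpow t ht]
    exact Real.hasDerivAt_arcsin (by linarith) (by linarith)
  refine ⟨_, (h.const_mul (c := 2 / Real.pi) (by positivity)).congr fun t _ => by simp⟩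

/-- Substitute into (1 - x)^(-q), using arccos t = (π / 2)(1 - (2 / π) arcsin t). -/
lemma exists_isNonnegSeries_arccos_rpow {q : ℝ} (hq : 0 ≤ q) :
    ∃ e, IsNonnegSeries e fun t => Real.arccos t ^ (-q) := by
  obtain ⟨a, ha⟩ := exists_isNonnegSeries_arcsin
  have hpi := Real.pi_pos
  obtain ⟨e, he⟩ := (isNonnegSeries_one_sub_rpow hq).exists_comp ha fun t h0 h1 => by
    have := (Real.arcsin_lt_pi_div_two).2 h1
    calc 2 / Real.pi * Real.arcsin t < 2 / Real.pi * (Real.pi / 2) := by gcongr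
      _ = 1 := by field_simp
  refine ⟨_, (he.const_mul (c := (Real.pi / 2) ^ (-q)) (by positivity)).congr fun t ht => ?_⟩
  have hx := (Real.arcsin_le_pi_div_two t)
  have h1 : 0 ≤ 1 - 2 / Real.pi * Real.arcsin t := by
    have : 2 / Real.pi * Real.arcsin t ≤ 2 / Real.pi * (Real.pi / 2) := by gcongr
    have h2 : 2 / Real.pi * (Real.pi / 2) = 1 := by field_simp
    linarith
  rw [← Real.mul_rpow (by positivity) h1]
  congr 1
  rw [Real.arccos]
  field_simp

lemma negBinomCoeff_half_antitone : Antitone (negBinomCoeff (1 / 2)) := by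
  refine antitone_nat_of_succ_le fun n => ?_
  rw [negBinomCoeff_succ]
  refine mul_le_of_le_one_right (negBinomCoeff_nonneg (by norm_num) n) ?_
  rw [div_le_one (by positivity)]
  linarith

/-- A Wallis-type bound: n times the square of the n-th coefficient is nondecreasing from n = 1,
because (n + 1)(n + 2) ≤ (n + 3/2)². -/
lemma le_negBinomCoeff_half (n : ℕ) : 1 / 2 * ((n : ℝ) + 1) ^ (-(1 / 2) : ℝ) ≤
    negBinomCoeff (1 / 2) n := by
  have key : ∀ n : ℕ, 1 ≤ 4 * ((n : ℝ) + 1) * negBinomCoeff (1 / 2) (n + 1) ^ 2 := by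
    intro n
    induction n with
    | zero => norm_num [negBinomCoeff]
    | succ n ih =>
      refine ih.trans ?_
      rw [negBinomCoeff_succ _ (n + 1)]
      have h0 := sq_nonneg (negBinomCoeff (1 / 2) (n + 1))
      have h1 : (n : ℝ) + 1 ≤ ((n : ℝ) + 2) * ((1 / 2 + (n + 1)) / (n + 1 + 1)) ^ 2 := by
        rw [div_pow, mul_div_assoc', le_div_iff₀ (by positivity)]
        nlinarith
      push_cast
      nlinarith [mul_le_mul_of_nonneg_right h1 h0]
  have key' : 1 ≤ 4 * ((n : ℝ) + 1) * negBinomCoeff (1 / 2) n ^ 2 := by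
    refine (key n).trans ?_
    have := negBinomCoeff_half_antitone (Nat.le_succ n)
    have := negBinomCoeff_nonneg (q := 1 / 2) (by norm_num) (n + 1)
    gcongr
  have h0 := negBinomCoeff_nonneg (q := 1 / 2) (by norm_num) n
  rw [Real.rpow_neg (by positivity), ← Real.sqrt_eq_rpow]
  have hs : 0 < √((n : ℝ) + 1) := by positivity
  have hsq : √((n : ℝ) + 1) ^ 2 = n + 1 := Real.sq_sqrt (by positivity)
  rw [← div_eq_mul_inv, div_le_iff₀ hs]
  refine le_of_sq_le_sq ?_ (by positivity)
  rw [mul_pow, hsq]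
  nlinarith

lemma sqrt_one_sub_sq_le_arccos (t : ℝ) : √(1 - t ^ 2) ≤ Real.arccos t := by
  rw [← Real.sin_arccos]
  exact Real.sin_le (Real.arccos_nonneg t)

lemma arccos_le_sqrt_one_sub_sq {t : ℝ} (h0 : 0 ≤ t) :
    Real.arccos t ≤ Real.pi / 2 * √(1 - t ^ 2) := by
  have := Real.mul_le_sin (Real.arccos_nonneg t) (Real.arccos_le_pi_div_two.2 h0)
  rw [Real.sin_arccos] at this
  calc Real.arccos t = Real.pi / 2 * (2 / Real.pi * Real.arccos t) := by
        field_simp [Real.pi_ne_zero]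
    _ ≤ _ := by gcongr

/-- Partial sums of the even coefficients of a nonnegative series for `arccos ^ (-q)`. -/
lemma exists_le_sum_range_arccos {q : ℝ} (hq : 0 ≤ q) {e : ℕ → ℝ}
    (he : IsNonnegSeries e fun t => Real.arccos t ^ (-q)) :
    ∃ κ > 0, ∀ k : ℕ, κ * ((k : ℝ) + 1) ^ (q / 2) ≤ ∑ j ∈ Finset.range (k + 1), e (2 * j) := by
  have hpi := Real.pi_pos
  have aux : ∀ r : ℝ, 0 ≤ r → r < 1 → 0 ≤ √r ∧ √r < 1 ∧ √r ^ 2 = r := fun r h0 h1 =>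
    ⟨Real.sqrt_nonneg r, by rw [Real.sqrt_lt' one_pos]; simpa using h1, Real.sq_sqrt h0⟩
  have hpow : ∀ r : ℝ, r < 1 → √(1 - r) ^ (-q) = (1 - r) ^ (-(q / 2)) := fun r h1 => by
    rw [Real.sqrt_eq_rpow, ← Real.rpow_mul (by linarith)]
    ring_nf
  -- The even part of arccos^(-q) at √r has coefficients e (2 * j) in r. The bounds hold because
  -- arccos √r is comparable to √(1 - r).
  refine exists_le_sum_range (a := fun j => e (2 * j)) (C := 1)
    (c := 1 / 2 * (Real.pi / 2) ^ (-q)) (β := q / 2)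
    (A := fun r => 1 / 2 * (Real.arccos √r ^ (-q) + Real.arccos (-√r) ^ (-q)))
    (by positivity) (by positivity) (fun n => he.1 _) ?_ ?_ ?_
  · intro r h0 h1
    obtain ⟨hs0, hs1, hs2⟩ := aux r h0 h1
    have hab : |√r| < 1 := by rwa [abs_of_nonneg hs0]
    have h := ((he.2 (√r) hab).add (he.2 (-√r) (by rwa [abs_neg]))).mul_left (1 / 2)
    rw [← (mul_right_injective₀ (two_ne_zero (α := ℕ))).hasSum_iff] at h
    · refine h.congr_terms fun j => ?_
      simp only [Function.comp_apply, pow_mul, neg_sq, hs2]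
      ring
    · intro n hn
      have hodd : Odd n := by
        rw [← Nat.not_even_iff_odd, even_iff_exists_two_mul]
        rintro ⟨k, rfl⟩
        exact hn ⟨k, rfl⟩
      rw [hodd.neg_pow]
      ring
  · intro r h0 h1
    obtain ⟨hs0, hs1, hs2⟩ := aux r h0 h1
    have h2 := arccos_le_sqrt_one_sub_sq hs0
    rw [hs2] at h2
    have hpos : 0 < Real.arccos √r := Real.arccos_pos.2 hs1
    have h3 := Real.rpow_le_rpow_of_nonpos hpos h2 (neg_nonpos.2 hq)
    rw [Real.mul_rpow (by positivity) (Real.sqrt_nonneg _), hpow r h1] at h3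
    have h4 : 0 ≤ Real.arccos (-√r) ^ (-q) := Real.rpow_nonneg (Real.arccos_nonneg _) _
    linarith
  · intro r h0 h1
    obtain ⟨hs0, hs1, hs2⟩ := aux r h0 h1
    have h2 := sqrt_one_sub_sq_le_arccos √r
    rw [hs2] at h2
    have hpos : 0 < Real.arccos √r := Real.arccos_pos.2 hs1
    have h3 := Real.rpow_le_rpow_of_nonpos (Real.sqrt_pos.2 (by linarith)) h2 (neg_nonpos.2 hq)
    rw [hpow r h1] at h3
    have h4 : Real.arccos (-√r) ^ (-q) ≤ Real.arccos √r ^ (-q) :=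
      Real.rpow_le_rpow_of_nonpos hpos (Real.antitone_arccos (by linarith)) (neg_nonpos.2 hq)
    linarith

/-- `arccos ^ p` is `∑ c n * (1 - t ^ n)` with nonnegative `c`, whose odd terms decay no faster
than `n ^ (-1 - p / 2)`. -/
lemma exists_hasSum_arccos_rpow {p : ℝ} (hp0 : 0 < p) (hp1 : p ≤ 1) :
    ∃ c : ℕ → ℝ, (∀ n, 0 ≤ c n) ∧ Summable c ∧
      (∀ t ∈ Set.Icc (-1 : ℝ) 1, HasSum (fun n => c n * (1 - t ^ n)) (Real.arccos t ^ p)) ∧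
      ∃ κ > 0, ∀ k : ℕ, κ * ((k : ℝ) + 1) ^ (-1 - p / 2) ≤ c (2 * k + 1) := by
  have hpi := Real.pi_pos
  obtain ⟨e, he⟩ := exists_isNonnegSeries_arccos_rpow (q := 1 - p) (by linarith)
  obtain ⟨κ, hκ, hsum⟩ := exists_le_sum_range_arccos (by linarith) he
  -- This is the series of the derivative of -arccos^p; p ≤ 1 makes the exponent p - 1 nonpositive.
  have hD := (he.mul isNonnegSeries_inv_sqrt).const_mul hp0.le
  set D : ℕ → ℝ := fun n => p * ∑ k ∈ Finset.range (n + 1), e k * invSqrtCoeff (n - k) with hDdef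
  have hc := hD.integral (F := fun t => (Real.pi / 2) ^ p - Real.arccos t ^ p) fun t ht => by
    have ht' := abs_lt.1 ht
    have h1 := (Real.hasDerivAt_arccos (x := t) (by linarith) (by linarith)).rpow_const (p := p)
      (Or.inl (Real.arccos_pos.2 ht'.2).ne')
    refine (h1.const_sub _).congr_deriv ?_
    rw [← inv_sqrt_eq_rpow t ht, neg_sub]
    ring
  have hc := hc.congr (g := fun t => (Real.pi / 2) ^ p - Real.arccos t ^ p) fun t _ => by simp
  set c : ℕ → ℝ := fun n => if n = 0 then 0 else D (n - 1) / n with hcdef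
  have hcs : Summable c := hc.summable_of_le (C := (Real.pi / 2) ^ p) fun t _ _ => by
    have := Real.rpow_nonneg (Real.arccos_nonneg t) p
    linarith
  have hcont : Continuous fun t => (Real.pi / 2) ^ p - Real.arccos t ^ p :=
    continuous_const.sub (Real.continuous_arccos.rpow_const fun _ => Or.inr hp0.le)
  have hall : ∀ t ∈ Set.Icc (-1 : ℝ) 1,
      HasSum (fun n => c n * t ^ n) ((Real.pi / 2) ^ p - Real.arccos t ^ p) := fun t ht =>
    hasSum_pow_Icc hcs.abs hcont.continuousOn hc.2 ht
  refine ⟨c, hc.1, hcs, fun t ht => ?_, κ * (p / 4), by positivity, fun k => ?_⟩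
  · have h1 := hall 1 (by norm_num)
    have h2 := h1.sub (hall t ht)
    simp only [Real.arccos_one, Real.zero_rpow hp0.ne'] at h2
    have h3 : Real.arccos t ^ p = (Real.pi / 2) ^ p - 0 - ((Real.pi / 2) ^ p - Real.arccos t ^ p) := by
      ring
    rw [h3]
    exact h2.congr_terms fun n => by rw [one_pow]; ring
  · have hk : (0 : ℝ) < k + 1 := by positivity
    -- Only even indices contribute to the convolution, and the second factor is decreasing, so its
    -- last value can be pulled out.
    have hconv : (∑ j ∈ Finset.range (k + 1), e (2 * j)) * negBinomCoeff (1 / 2) k ≤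
        ∑ i ∈ Finset.range (2 * k + 1), e i * invSqrtCoeff (2 * k - i) := by
      rw [Finset.sum_mul]
      calc ∑ j ∈ Finset.range (k + 1), e (2 * j) * negBinomCoeff (1 / 2) k
          ≤ ∑ j ∈ Finset.range (k + 1), e (2 * j) * invSqrtCoeff (2 * k - 2 * j) := by
            refine Finset.sum_le_sum fun j hj => mul_le_mul_of_nonneg_left ?_ (he.1 _)
            rw [← Nat.mul_sub, invSqrtCoeff, if_pos (even_two_mul _),
              Nat.mul_div_cancel_left _ (by norm_num)]
            exact negBinomCoeff_half_antitone (Nat.sub_le _ _)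
        _ = ∑ i ∈ (Finset.range (k + 1)).image (2 * ·), e i * invSqrtCoeff (2 * k - i) := by
            rw [Finset.sum_image fun x _ y _ h => by simpa using h]
        _ ≤ _ := by
            refine Finset.sum_le_sum_of_subset_of_nonneg ?_ fun i _ _ =>
              mul_nonneg (he.1 _) (isNonnegSeries_inv_sqrt.1 _)
            intro i hi
            obtain ⟨j, hj, rfl⟩ := Finset.mem_image.1 hi
            simp only [Finset.mem_range] at hj ⊢
            omega
    have h1 := hsum k
    have h2 := le_negBinomCoeff_half k
    have hpow : ((k : ℝ) + 1) ^ (-1 - p / 2) =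
        ((k : ℝ) + 1) ^ ((1 - p) / 2) * ((k : ℝ) + 1) ^ (-(1 / 2) : ℝ) * ((k : ℝ) + 1)⁻¹ := by
      rw [← Real.rpow_neg_one, ← Real.rpow_add hk, ← Real.rpow_add hk]
      ring_nf
    have h3 : κ * ((k : ℝ) + 1) ^ ((1 - p) / 2) * (1 / 2 * ((k : ℝ) + 1) ^ (-(1 / 2) : ℝ)) ≤
        ∑ i ∈ Finset.range (2 * k + 1), e i * invSqrtCoeff (2 * k - i) := by
      refine le_trans ?_ hconv
      exact mul_le_mul h1 h2 (by positivity) ((by positivity : (0 : ℝ) ≤ _).trans h1)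
    have hck : c (2 * k + 1) = p * (∑ i ∈ Finset.range (2 * k + 1),
        e i * invSqrtCoeff (2 * k - i)) / (2 * k + 1) := by
      simp [hcdef, hDdef]
    rw [hck, hpow, le_div_iff₀ (by positivity)]
    have h4 : ((k : ℝ) + 1)⁻¹ * (2 * k + 1) ≤ 2 := by
      rw [inv_mul_le_iff₀ hk]
      linarith
    calc _ = p * (κ * ((k : ℝ) + 1) ^ ((1 - p) / 2) * (1 / 2 * ((k : ℝ) + 1) ^ (-(1 / 2) : ℝ)))
          * (1 / 2) * (((k : ℝ) + 1)⁻¹ * (2 * k + 1)) := by ring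
      _ ≤ p * (κ * ((k : ℝ) + 1) ^ ((1 - p) / 2) * (1 / 2 * ((k : ℝ) + 1) ^ (-(1 / 2) : ℝ)))
          * (1 / 2) * 2 := by gcongr
      _ = p * (κ * ((k : ℝ) + 1) ^ ((1 - p) / 2) * (1 / 2 * ((k : ℝ) + 1) ^ (-(1 / 2) : ℝ))) := by
          ring
      _ ≤ _ := by gcongr

/-! ### The expansion of the zonal function -/

/-- By Bernoulli, the ratio of consecutive coefficients, 1 - (1 + h)/(n + 2), is at most ((n + 1)/(n
+ 2))^(1 + h), and these bounds telescope. -/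
lemma negBinomCoeff_neg_bound {h : ℝ} (h0 : 0 < h) (h1 : h < 1) (n : ℕ) :
    negBinomCoeff (-h) (n + 1) ≤ 0 ∧
      -negBinomCoeff (-h) (n + 1) ≤ h * ((n : ℝ) + 1) ^ (-1 - h) := by
  induction n with
  | zero => simp [negBinomCoeff, h0.le]
  | succ n ih =>
    have hn : (0 : ℝ) < n + 1 := by positivity
    have hn2 : (0 : ℝ) < n + 2 := by positivity
    have hfac : 0 ≤ (-h + ((n + 1 : ℕ) : ℝ)) / (((n + 1 : ℕ) : ℝ) + 1) := by
      refine div_nonneg ?_ (by positivity)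
      push_cast
      have : (0 : ℝ) ≤ n := Nat.cast_nonneg n
      linarith
    rw [negBinomCoeff_succ _ (n + 1)]
    refine ⟨mul_nonpos_of_nonpos_of_nonneg ih.1 hfac, ?_⟩
    have hB : (-h + ((n + 1 : ℕ) : ℝ)) / (((n + 1 : ℕ) : ℝ) + 1) ≤
        (((n : ℝ) + 1) / (n + 2)) ^ (1 + h) := by
      have := one_add_mul_self_le_rpow_one_add (s := -(1 / ((n : ℝ) + 2)))
        (by rw [neg_le_neg_iff, div_le_one hn2]; linarith [(Nat.cast_nonneg n : (0 : ℝ) ≤ n)])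
        (p := 1 + h) (by linarith)
      convert this using 1
      · push_cast; field_simp; ring
      · congr 1; field_simp; ring
    rw [Real.div_rpow hn.le hn2.le] at hB
    calc -(negBinomCoeff (-h) (n + 1) * ((-h + ((n + 1 : ℕ) : ℝ)) / (((n + 1 : ℕ) : ℝ) + 1)))
        = -negBinomCoeff (-h) (n + 1) * ((-h + ((n + 1 : ℕ) : ℝ)) / (((n + 1 : ℕ) : ℝ) + 1)) := by
          ring
      _ ≤ (h * ((n : ℝ) + 1) ^ (-1 - h)) * (((n : ℝ) + 1) ^ (1 + h) / ((n : ℝ) + 2) ^ (1 + h)) := by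
          exact mul_le_mul ih.2 hB hfac (by positivity)
      _ = h * (((n : ℝ) + 1) ^ (-1 - h) * ((n : ℝ) + 1) ^ (1 + h)) * (((n : ℝ) + 2) ^ (1 + h))⁻¹ := by
          ring
      _ = _ := by
          rw [← Real.rpow_add hn, ← Real.rpow_neg hn2.le]
          push_cast
          ring_nf
          simp

/-- The odd function `(1 + t) ^ h - (1 - t) ^ h` as a series in odd powers of `t`. -/
lemma exists_hasSum_auxG {h : ℝ} (h0 : 0 < h) (h1 : h < 1) :
    ∃ b : ℕ → ℝ, (∀ k, 0 ≤ b k) ∧ (∀ k, b k ≤ 2 * ((k : ℝ) + 1) ^ (-1 - h)) ∧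
      ∀ t ∈ Set.Icc (-1 : ℝ) 1,
        HasSum (fun k => b k * (1 - t ^ (2 * k + 1))) (auxG h 1 - auxG h t) := by
  set u : ℕ → ℝ := negBinomCoeff (-h) with hu
  have hcont : ContinuousOn (fun t : ℝ => (1 - t) ^ h) (Set.Icc (-1) 1) :=
    ((continuous_const.sub continuous_id).rpow_const fun _ => Or.inr h0.le).continuousOn
  have hus : Summable fun n => |u n| := by
    rw [← summable_nat_add_iff 1]
    refine Summable.of_nonneg_of_le (fun _ => abs_nonneg _) (fun n => ?_)
      (((summable_nat_add_iff 1).2 (Real.summable_nat_rpow.2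
        (show -1 - h < -1 by linarith))).mul_left h)
    have := negBinomCoeff_neg_bound h0 h1 n
    rw [abs_of_nonpos this.1]
    push_cast
    exact this.2
  have hs : ∀ t ∈ Set.Icc (-1 : ℝ) 1, HasSum (fun n => u n * t ^ n) ((1 - t) ^ h) := by
    intro t ht
    refine hasSum_pow_Icc hus hcont (fun t ht => ?_) ht
    simpa using hasSum_negBinomCoeff (-h) ht
  have hphi : ∀ t ∈ Set.Icc (-1 : ℝ) 1,
      HasSum (fun k => -2 * u (2 * k + 1) * t ^ (2 * k + 1)) ((1 + t) ^ h - (1 - t) ^ h) := by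
    intro t ht
    have h2 := (hs (-t) ⟨by linarith [ht.2], by linarith [ht.1]⟩).sub (hs t ht)
    rw [sub_neg_eq_add, ← (show Function.Injective fun k : ℕ => 2 * k + 1 from
      fun a b hab => by simpa using hab).hasSum_iff] at h2
    · refine h2.congr_terms fun k => ?_
      simp only [Function.comp_apply, (odd_two_mul_add_one k).neg_pow]
      ring
    · intro n hn
      have : Even n := by
        rw [← Nat.not_odd_iff_even]
        rintro ⟨k, rfl⟩
        exact hn ⟨k, rfl⟩
      rw [this.neg_pow, sub_self]
  refine ⟨fun k => -2 * u (2 * k + 1), fun k => ?_, fun k => ?_, fun t ht => ?_⟩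
  · have := (negBinomCoeff_neg_bound h0 h1 (2 * k)).1
    simp only [hu]
    linarith
  · have h2 := (negBinomCoeff_neg_bound h0 h1 (2 * k)).2
    have h3 : (((2 * k : ℕ) : ℝ) + 1) ^ (-1 - h) ≤ ((k : ℝ) + 1) ^ (-1 - h) := by
      refine Real.rpow_le_rpow_of_nonpos (by positivity) ?_ (by linarith)
      push_cast
      linarith [(Nat.cast_nonneg k : (0 : ℝ) ≤ k)]
    have h4 : h * (((2 * k : ℕ) : ℝ) + 1) ^ (-1 - h) ≤ 1 * ((k : ℝ) + 1) ^ (-1 - h) := by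
      gcongr
    simp only [hu]
    linarith
  · have h2 := (hphi 1 (by norm_num)).sub (hphi t ht)
    have h3 : auxG h 1 - auxG h t =
        (1 + 1) ^ h - (1 - 1) ^ h - ((1 + t) ^ h - (1 - t) ^ h) := by
      unfold auxG
      ring
    rw [h3]
    exact h2.congr_terms fun k => by rw [one_pow]; ring

/-! ### Tensor powers and the covariance form -/

open scoped InnerProductSpace

/-- The `m`-th tensor power of a vector of `ℝ^d`, in coordinates. -/
noncomputable def tensorPow {d : ℕ} (m : ℕ) (v : EuclideanSpace ℝ (Fin d)) :
    EuclideanSpace ℝ (Fin m → Fin d) :=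
  WithLp.toLp 2 fun σ => ∏ k, v (σ k)

lemma inner_tensorPow {d : ℕ} (m : ℕ) (v w : EuclideanSpace ℝ (Fin d)) :
    ⟪tensorPow m v, tensorPow m w⟫_ℝ = ⟪v, w⟫_ℝ ^ m := by
  simp only [PiLp.inner_apply, tensorPow, RCLike.inner_apply, conj_trivial]
  rw [← Fin.prod_const, Finset.prod_univ_sum]
  simp [Finset.prod_mul_distrib]

/-- The right side is ‖w‖² for w = ∑ a_i (u^⊗m - v_i^⊗m), and the left side is ⟨w, u^⊗m⟩² with u^⊗m
a unit vector: Cauchy-Schwarz. -/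
lemma sq_sum_le_sum_sum {d : ℕ} (m : ℕ) {u : EuclideanSpace ℝ (Fin d)} (hu : ‖u‖ = 1)
    {ι : Type*} (s : Finset ι) (a : ι → ℝ) (v : ι → EuclideanSpace ℝ (Fin d)) :
    (∑ i ∈ s, a i * (1 - ⟪v i, u⟫_ℝ ^ m)) ^ 2 ≤
      ∑ i ∈ s, ∑ j ∈ s, a i * a j *
        ((1 - ⟪v i, u⟫_ℝ ^ m) + (1 - ⟪v j, u⟫_ℝ ^ m) - (1 - ⟪v i, v j⟫_ℝ ^ m)) := by
  set T := tensorPow (d := d) m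
  have huu : ⟪T u, T u⟫_ℝ = 1 := by rw [inner_tensorPow, real_inner_self_eq_norm_sq, hu]; simp
  have hTu : ‖T u‖ = 1 := by
    rw [real_inner_self_eq_norm_sq] at huu
    exact (pow_eq_one_iff_of_nonneg (norm_nonneg _) two_ne_zero).1 huu
  have h1 := abs_real_inner_le_norm (∑ i ∈ s, a i • (T u - T (v i))) (T u)
  rw [hTu, mul_one] at h1
  have h2 := pow_le_pow_left₀ (abs_nonneg _) h1 2
  rw [sq_abs, ← real_inner_self_eq_norm_sq] at h2
  simp only [sum_inner, inner_sum, real_inner_smul_left, real_inner_smul_right, inner_sub_left,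
    inner_sub_right, huu] at h2
  simp only [T, inner_tensorPow] at h2
  refine h2.trans_eq (Finset.sum_congr rfl fun i _ => Finset.sum_congr rfl fun j _ => ?_)
  rw [real_inner_comm (v i) u, real_inner_comm (v i) (v j)]
  ring

lemma inner_mem_Icc {d : ℕ} (η ζ : UnitSphere d) :
    ⟪(η : EuclideanSpace ℝ (Fin d)), (ζ : EuclideanSpace ℝ (Fin d))⟫_ℝ ∈ Set.Icc (-1 : ℝ) 1 := by
  have h := abs_real_inner_le_norm (η : EuclideanSpace ℝ (Fin d)) (ζ : EuclideanSpace ℝ (Fin d))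
  rw [norm_eq_of_mem_sphere, norm_eq_of_mem_sphere, mul_one] at h
  exact abs_le.1 h

/-- Expansion of the covariance form along the powers of the inner product. -/
lemma hasSum_sfbmCov {d : ℕ} {H : ℝ} {c : ℕ → ℝ}
    (hc : ∀ t ∈ Set.Icc (-1 : ℝ) 1,
      HasSum (fun n => c n * (1 - t ^ n)) (Real.arccos t ^ (2 * H)))
    (O : UnitSphere d) (s : Finset (UnitSphere d)) (a : UnitSphere d → ℝ) :
    HasSum (fun n => c n * ∑ η ∈ s, ∑ ζ ∈ s, a η * a ζ *
        ((1 - ⟪η.1, O.1⟫_ℝ ^ n) + (1 - ⟪ζ.1, O.1⟫_ℝ ^ n) - (1 - ⟪η.1, ζ.1⟫_ℝ ^ n)))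
      (2 * ∑ η ∈ s, ∑ ζ ∈ s, a η * a ζ * sfbmCov H O η ζ) := by
  have h : HasSum (fun n => ∑ η ∈ s, ∑ ζ ∈ s, a η * a ζ * ((c n * (1 - ⟪η.1, O.1⟫_ℝ ^ n) +
      c n * (1 - ⟪ζ.1, O.1⟫_ℝ ^ n) - c n * (1 - ⟪η.1, ζ.1⟫_ℝ ^ n))))
      (∑ η ∈ s, ∑ ζ ∈ s, a η * a ζ * (geodesicDist η O ^ (2 * H) + geodesicDist ζ O ^ (2 * H)
        - geodesicDist η ζ ^ (2 * H))) :=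
    hasSum_sum fun η _ => hasSum_sum fun ζ _ => HasSum.mul_left _
      (((hc _ (inner_mem_Icc η O)).add (hc _ (inner_mem_Icc ζ O))).sub
        (hc _ (inner_mem_Icc η ζ)))
  have h' : (∑ η ∈ s, ∑ ζ ∈ s, a η * a ζ * (geodesicDist η O ^ (2 * H) +
      geodesicDist ζ O ^ (2 * H) - geodesicDist η ζ ^ (2 * H))) =
      2 * ∑ η ∈ s, ∑ ζ ∈ s, a η * a ζ * sfbmCov H O η ζ := by
    simp only [Finset.mul_sum]
    refine Finset.sum_congr rfl fun η _ => Finset.sum_congr rfl fun ζ _ => ?_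
    unfold sfbmCov
    ring
  rw [← h']
  refine h.congr_terms fun n => ?_
  simp only [Finset.mul_sum]
  refine Finset.sum_congr rfl fun η _ => Finset.sum_congr rfl fun ζ _ => ?_
  ring

lemma sfbmCov_sum_nonneg {d : ℕ} {H : ℝ} (hH0 : 0 < H) (hH : H ≤ 1 / 2) (O : UnitSphere d)
    (s : Finset (UnitSphere d)) (a : UnitSphere d → ℝ) :
    0 ≤ ∑ η ∈ s, ∑ ζ ∈ s, a η * a ζ * sfbmCov H O η ζ := by
  obtain ⟨c, hc0, -, hc, -⟩ := exists_hasSum_arccos_rpow (p := 2 * H) (by linarith) (by linarith)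
  have := (hasSum_sfbmCov hc O s a).nonneg fun n => mul_nonneg (hc0 n)
    ((sq_nonneg _).trans (sq_sum_le_sum_sum n (norm_eq_of_mem_sphere O) s a fun η => η.1))
  linarith

/-- Weighted Cauchy-Schwarz inequality for series. -/
lemma sq_le_mul_of_hasSum {b c L : ℕ → ℝ} {S A : ℝ} {B : ℝ} (hc : ∀ k, 0 < c k)
    (hS : HasSum (fun k => b k * L k) S) (hA : ∀ N, ∑ k ∈ Finset.range N, b k ^ 2 / c k ≤ A)
    (hB : ∀ N, ∑ k ∈ Finset.range N, c k * L k ^ 2 ≤ B) : S ^ 2 ≤ A * B := by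
  have hA0 : 0 ≤ A := by simpa using hA 0
  refine le_of_tendsto ((hS.tendsto_sum_nat).pow 2) (Filter.Eventually.of_forall fun N => ?_)
  have h := Finset.sum_sq_le_sum_mul_sum_of_sq_le_mul (Finset.range N)
    (r := fun k => b k * L k) (f := fun k => b k ^ 2 / c k) (g := fun k => c k * L k ^ 2)
    (fun k _ => div_nonneg (sq_nonneg _) (hc k).le)
    (fun k _ => mul_nonneg (hc k).le (sq_nonneg _))
    (fun k _ => by
      have := (hc k).ne'
      refine le_of_eq ?_
      field_simp)
  refine h.trans (mul_le_mul (hA N) (hB N) ?_ hA0)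
  exact Finset.sum_nonneg fun k _ => mul_nonneg (hc k).le (sq_nonneg _)

/-- The zonal function `G(1) - G(⟨·, O⟩)` is bounded by the covariance form, uniformly in `O`. -/
lemma exists_sq_sum_auxG_le {H α : ℝ} (d : ℕ) (hH0 : 0 < H) (hH : H ≤ 1 / 2) (hα0 : 0 < α)
    (hα : α < 1 / 2) :
    ∃ C > 0, ∀ (O : UnitSphere d) (s : Finset (UnitSphere d)) (a : UnitSphere d → ℝ),
      (∑ η ∈ s, a η * (auxG ((H + α) / 2) 1 - auxG ((H + α) / 2) ⟪η.1, O.1⟫_ℝ)) ^ 2 ≤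
        C * ∑ η ∈ s, ∑ ζ ∈ s, a η * a ζ * sfbmCov H O η ζ := by
  obtain ⟨c, hc0, hcs, hc, κ, hκ, hck⟩ :=
    exists_hasSum_arccos_rpow (p := 2 * H) (by linarith) (by linarith)
  obtain ⟨b, hb0, hb1, hb⟩ := exists_hasSum_auxG (h := (H + α) / 2) (by linarith) (by linarith)
  have hcpos : ∀ k, 0 < c (2 * k + 1) := fun k => lt_of_lt_of_le (by positivity) (hck k)
  -- The exponents combine as 2(-1 - (H + α)/2) - (-1 - H) = -1 - α, which is summable since α > 0.
  have hbc : ∀ k, b k ^ 2 / c (2 * k + 1) ≤ 4 / κ * (((k + 1 : ℕ) : ℝ) ^ (-1 - α)) := by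
    intro k
    have hk : (0 : ℝ) < k + 1 := by positivity
    have h2 : (2 * ((k : ℝ) + 1) ^ (-1 - (H + α) / 2)) ^ 2 =
        4 / κ * (((k + 1 : ℕ) : ℝ) ^ (-1 - α)) * (κ * ((k : ℝ) + 1) ^ (-1 - 2 * H / 2)) := by
      have : ((k : ℝ) + 1) ^ (-1 - α) * ((k : ℝ) + 1) ^ (-1 - 2 * H / 2) =
          (((k : ℝ) + 1) ^ (-1 - (H + α) / 2)) ^ 2 := by
        rw [← Real.rpow_add hk, ← Real.rpow_natCast, ← Real.rpow_mul hk.le]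
        congr 1
        push_cast
        ring
      push_cast
      rw [mul_pow, ← this]
      field_simp
      norm_num
    rw [div_le_iff₀ (hcpos k)]
    calc b k ^ 2 ≤ (2 * ((k : ℝ) + 1) ^ (-1 - (H + α) / 2)) ^ 2 :=
          pow_le_pow_left₀ (hb0 k) (hb1 k) 2
      _ = _ := h2
      _ ≤ _ := by
        refine mul_le_mul_of_nonneg_left (hck k) (by positivity)
  have hsum : Summable fun k : ℕ => 4 / κ * (((k + 1 : ℕ) : ℝ) ^ (-1 - α)) :=
    ((summable_nat_add_iff 1).2 (Real.summable_nat_rpow.2 (by linarith))).mul_left _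
  set A := ∑' k : ℕ, 4 / κ * (((k + 1 : ℕ) : ℝ) ^ (-1 - α)) with hA
  have hA0 : 0 ≤ A := tsum_nonneg fun k => by positivity
  -- The 2 undoes the 1/2 in the covariance; the + 1 only secures positivity.
  refine ⟨2 * (A + 1), by positivity, fun O s a => ?_⟩
  have hQ0 := sfbmCov_sum_nonneg hH0 hH O s a
  have hS : HasSum (fun k => b k * ∑ η ∈ s, a η * (1 - ⟪η.1, O.1⟫_ℝ ^ (2 * k + 1)))
      (∑ η ∈ s, a η * (auxG ((H + α) / 2) 1 - auxG ((H + α) / 2) ⟪η.1, O.1⟫_ℝ)) := by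
    have : HasSum (fun k => ∑ η ∈ s, a η * (b k * (1 - ⟪η.1, O.1⟫_ℝ ^ (2 * k + 1)))) _ :=
      hasSum_sum fun η _ => (hb _ (inner_mem_Icc η O)).mul_left (a η)
    refine this.congr_terms fun k => ?_
    rw [Finset.mul_sum]
    exact Finset.sum_congr rfl fun η _ => by ring
  have hQ := hasSum_sfbmCov hc O s a
  have hnn : ∀ n, 0 ≤ ∑ η ∈ s, ∑ ζ ∈ s, a η * a ζ *
        ((1 - ⟪η.1, O.1⟫_ℝ ^ n) + (1 - ⟪ζ.1, O.1⟫_ℝ ^ n) - (1 - ⟪η.1, ζ.1⟫_ℝ ^ n)) := fun n =>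
    (sq_nonneg _).trans (sq_sum_le_sum_sum n (norm_eq_of_mem_sphere O) s a fun η => η.1)
  have h := sq_le_mul_of_hasSum hcpos hS (A := A)
    (B := 2 * ∑ η ∈ s, ∑ ζ ∈ s, a η * a ζ * sfbmCov H O η ζ) ?_ ?_
  · nlinarith
  · intro N
    refine (Finset.sum_le_sum fun k _ => hbc k).trans ?_
    exact hsum.sum_le_tsum _ fun k _ => by positivity
  · intro N
    -- The odd layers are part of the full expansion, whose remaining layers are nonnegative.
    have hinj : Function.Injective fun k : ℕ => 2 * k + 1 := fun a b hab => by simpa using hab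
    refine le_trans (Finset.sum_le_sum fun k _ => mul_le_mul_of_nonneg_left
      (sq_sum_le_sum_sum (2 * k + 1) (norm_eq_of_mem_sphere O) s a fun η => η.1) (hc0 _)) ?_
    rw [← Finset.sum_image (s := Finset.range N) (g := fun k : ℕ => 2 * k + 1)
      (f := fun n => c n * ∑ η ∈ s, ∑ ζ ∈ s, a η * a ζ *
        ((1 - ⟪η.1, O.1⟫_ℝ ^ n) + (1 - ⟪ζ.1, O.1⟫_ℝ ^ n) - (1 - ⟪η.1, ζ.1⟫_ℝ ^ n)))
      (hinj.injOn)]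
    exact sum_le_hasSum _ (fun n _ => mul_nonneg (hc0 n) (hnn n)) hQ

/-! ### Membership in the RKHS -/

/-- A function whose evaluation functional is bounded on combinations of kernel functions belongs
to the RKHS. -/
lemma RKHS.exists_eq_of_sq_le {X 𝓗 : Type*} [NormedAddCommGroup 𝓗] [InnerProductSpace ℝ 𝓗]
    [CompleteSpace 𝓗] [RKHS ℝ 𝓗 X ℝ] {f : X → ℝ} {C : ℝ} (hC : 0 ≤ C)
    (hf : ∀ a : X →₀ ℝ, (∑ x ∈ a.support, a x * f x) ^ 2 ≤
      C * ‖∑ x ∈ a.support, a x • RKHS.kerFun 𝓗 x (1 : ℝ)‖ ^ 2) :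
    ∃ F : 𝓗, (∀ x, F x = f x) ∧ ‖F‖ ^ 2 ≤ C := by
  set T : (X →₀ ℝ) →ₗ[ℝ] 𝓗 := Finsupp.linearCombination ℝ fun x => RKHS.kerFun 𝓗 x (1 : ℝ)
  set L : (X →₀ ℝ) →ₗ[ℝ] ℝ := Finsupp.linearCombination ℝ f
  have hTL : ∀ a, ‖L a‖ ≤ √C * ‖T a‖ := fun a => by
    refine abs_le_of_sq_le_sq ?_ (by positivity)
    rw [mul_pow, Real.sq_sqrt hC]
    simpa [T, L, Finsupp.linearCombination_apply, Finsupp.sum] using hf a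
  -- The bound makes L factor through the range of T, even when kernel functions are linearly
  -- dependent.
  have hker : LinearMap.ker T ≤ LinearMap.ker L := fun a ha => by
    have := hTL a
    rw [LinearMap.mem_ker.1 ha, norm_zero, mul_zero] at this
    exact LinearMap.mem_ker.2 (norm_le_zero_iff.1 this)
  let g₀ : LinearMap.range T →ₗ[ℝ] ℝ :=
    (LinearMap.ker T).liftQ L hker ∘ₗ T.quotKerEquivRange.symm.toLinearMap
  have hg₀ : ∀ a, g₀ ⟨T a, a, rfl⟩ = L a := fun a => by
    have : T.quotKerEquivRange.symm ⟨T a, a, rfl⟩ = (LinearMap.ker T).mkQ a := by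
      rw [LinearEquiv.symm_apply_eq]
      rfl
    simp [g₀, this]
  let g : StrongDual ℝ (LinearMap.range T) := g₀.mkContinuous √C <| by
    rintro ⟨_, a, rfl⟩
    rw [hg₀]
    exact hTL a
  -- Hahn-Banach extends the functional to the whole space without increasing its norm; its Riesz
  -- representative is F.
  obtain ⟨φ, hφ, hφn⟩ := exists_extension_norm_eq (LinearMap.range T) g
  refine ⟨(InnerProductSpace.toDual ℝ 𝓗).symm φ, fun x => ?_, ?_⟩
  · have h1 := RKHS.inner_kerFun x (1 : ℝ) ((InnerProductSpace.toDual ℝ 𝓗).symm φ)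
    rw [InnerProductSpace.toDual_symm_apply] at h1
    have h2 : RKHS.kerFun 𝓗 x (1 : ℝ) = T (Finsupp.single x 1) := by simp [T]
    have h3 : φ (T (Finsupp.single x 1)) = f x := by
      refine (hφ ⟨T (Finsupp.single x 1), _, rfl⟩).trans ((hg₀ _).trans ?_)
      simp [L]
    rw [h2, h3] at h1
    simpa using h1.symm
  · rw [LinearIsometryEquiv.norm_map, hφn, ← Real.sq_sqrt hC]
    gcongr
    exact LinearMap.mkContinuous_norm_le _ (Real.sqrt_nonneg _) _

lemma RKHS.norm_sum_smul_kerFun_sq {X 𝓗 : Type*} [NormedAddCommGroup 𝓗] [InnerProductSpace ℝ 𝓗]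
    [CompleteSpace 𝓗] [RKHS ℝ 𝓗 X ℝ] {K : X → X → ℝ} (hK : RKHS.kernel 𝓗 = realKernel K)
    (s : Finset X) (a : X → ℝ) :
    ‖∑ x ∈ s, a x • RKHS.kerFun 𝓗 x (1 : ℝ)‖ ^ 2 = ∑ x ∈ s, ∑ y ∈ s, a x * a y * K x y := by
  have h : ∀ x y, ⟪RKHS.kerFun 𝓗 x (1 : ℝ), RKHS.kerFun 𝓗 y (1 : ℝ)⟫_ℝ = K x y := fun x y => by
    rw [real_inner_comm, ← RKHS.kernel_inner, hK]
    simp [realKernel]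
  rw [← real_inner_self_eq_norm_sq]
  simp only [sum_inner, inner_sum, real_inner_smul_left, real_inner_smul_right, h]
  rw [Finset.sum_comm]
  exact Finset.sum_congr rfl fun x _ => Finset.sum_congr rfl fun y _ => by ring

lemma posSemidef_realKernel {X : Type*} {K : X → X → ℝ} (hsymm : ∀ x y, K x y = K y x)
    (h : ∀ (s : Finset X) (a : X → ℝ), 0 ≤ ∑ x ∈ s, ∑ y ∈ s, a x * a y * K x y) :
    (realKernel K).PosSemidef := by
  refine ((RKHS.posSemidef_tfae (𝕜 := ℝ) (K := realKernel K)).out 0 2).2 (And.intro ?_ fun v => ?_)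
  · ext x y
    have h1 : star (ContinuousLinearMap.id ℝ ℝ) = ContinuousLinearMap.id ℝ ℝ :=
      star_one (ℝ →L[ℝ] ℝ)
    simp [realKernel, hsymm x y, h1]
  · refine (h v.support v).trans_eq ?_
    simp only [Finsupp.sum, realKernel, RCLike.re_to_real]
    refine Finset.sum_congr rfl fun x _ => Finset.sum_congr rfl fun y _ => ?_
    simp [hsymm y x]
    ring

lemma sfbmCov_comm {d : ℕ} (H : ℝ) (O η ζ : UnitSphere d) :
    sfbmCov H O η ζ = sfbmCov H O ζ η := by
  unfold sfbmCov geodesicDist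
  rw [real_inner_comm η.1 ζ.1]
  ring

/-! ### The lower bound off the ball, and the theorem -/

lemma one_le_fDelta {d : ℕ} {H α : ℝ} (hpos : 0 < H + α) (O : UnitSphere d) {δ : ℝ} (hδ : 0 < δ)
    (η : UnitSphere d) (hη : η ∉ geodesicBall O δ) : 1 ≤ fDelta H α O δ η := by
  have hθ : δ < geodesicDist O η := not_le.1 hη
  set θ := geodesicDist O η with hθdef
  set t := ⟪η.1, O.1⟫_ℝ with ht
  have htI : t ∈ Set.Icc (-1 : ℝ) 1 := inner_mem_Icc η O
  have hcos : Real.cos θ = t := by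
    rw [hθdef, geodesicDist, real_inner_comm]
    exact Real.cos_arccos htI.1 htI.2
  have hθ0 : 0 < θ := hδ.trans hθ
  have hle := Real.cos_le_one_sub_mul_cos_sq (x := θ) (by
    rw [abs_of_pos hθ0]
    exact Real.arccos_le_pi _)
  -- The 16 is generous: 1 - cos θ ≥ 2θ²/π² on [0, π], and π < 4.
  have hquad : (θ / 16) ^ 2 ≤ 1 - t := by
    have h1 : (1 : ℝ) / 256 ≤ 2 / Real.pi ^ 2 := by
      rw [div_le_div_iff₀ (by norm_num) (by positivity)]
      nlinarith [Real.pi_lt_four, Real.pi_pos]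
    have h2 := mul_le_mul_of_nonneg_right h1 (sq_nonneg θ)
    rw [hcos] at hle
    calc (θ / 16) ^ 2 = 1 / 256 * θ ^ 2 := by ring
      _ ≤ _ := by linarith
  set h := (H + α) / 2 with hh
  have hh0 : 0 < h := by positivity
  have hpow : (θ / 16) ^ (H + α) ≤ (1 - t) ^ h := by
    have := Real.rpow_le_rpow (sq_nonneg _) hquad hh0.le
    rw [← Real.rpow_natCast, ← Real.rpow_mul (by positivity)] at this
    convert this using 2
    rw [hh]
    push_cast
    ring
  -- The difference equals (1 - t)^h + (2^h - (1 + t)^h), whose second part is nonnegative.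
  have hG : (1 - t) ^ h ≤ auxG h 1 - auxG h t := by
    have h1 : (1 + t) ^ h ≤ 2 ^ h :=
      Real.rpow_le_rpow (by linarith [htI.1]) (by linarith [htI.2]) hh0.le
    unfold auxG
    rw [sub_self, Real.zero_rpow hh0.ne']
    norm_num
    linarith
  unfold fDelta
  calc (1 : ℝ) ≤ (θ / δ) ^ (H + α) :=
        Real.one_le_rpow ((one_le_div hδ).2 hθ.le) hpos.le
    _ = 16 ^ (H + α) * (θ / 16) ^ (H + α) * δ ^ (-(H + α)) := by
        rw [← Real.mul_rpow (by norm_num) (by positivity), Real.rpow_neg hδ.le, ← div_eq_mul_inv,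
          ← Real.div_rpow (by positivity) hδ.le]
        congr 2
        ring
    _ ≤ _ := by
        gcongr
        exact hpow.trans hG

theorem mainTheorem5 (d : ℕ) (hd : 2 ≤ d) (H : ℝ) (hH0 : 0 < H) (hH : H ≤ 1 / 2)
    (α : ℝ) (hα0 : 0 < α) (hα : α < 1 / 2) :
    (∀ O : UnitSphere d, (sfbmKernel H O).PosSemidef) ∧
    ∃ c : ℝ, 0 < c ∧ ∀ (O : UnitSphere d) (δ : ℝ), 0 < δ →
      (∀ (𝓗 : Type*) [NormedAddCommGroup 𝓗] [InnerProductSpace ℝ 𝓗] [CompleteSpace 𝓗]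
          [RKHS ℝ 𝓗 (UnitSphere d) ℝ], RKHS.kernel 𝓗 = sfbmKernel H O →
        ∃ F : 𝓗, (∀ η, F η = fDelta H α O δ η) ∧ δ ^ (2 * (H + α)) * ‖F‖ ^ 2 ≤ c) ∧
      ∀ η : UnitSphere d, η ∉ geodesicBall O δ → 1 ≤ fDelta H α O δ η := by
  refine ⟨fun O => posSemidef_realKernel (sfbmCov_comm H O) (sfbmCov_sum_nonneg hH0 hH O), ?_⟩
  obtain ⟨C, hC, hbound⟩ := exists_sq_sum_auxG_le d hH0 hH hα0 hα
  refine ⟨((16 : ℝ) ^ (H + α)) ^ 2 * C, by positivity, fun O δ hδ =>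
    ⟨?_, fun η hη => one_le_fDelta (by positivity) O hδ η hη⟩⟩
  intro 𝓗 _ _ _ _ hK
  -- The criterion is applied to the unscaled zonal function; δ enters only through a scalar, whose
  -- square cancels the weight in (a).
  obtain ⟨F, hF, hFn⟩ := RKHS.exists_eq_of_sq_le (𝓗 := 𝓗) hC.le
    (f := fun η : UnitSphere d =>
      auxG ((H + α) / 2) 1 - auxG ((H + α) / 2) ⟪η.1, O.1⟫_ℝ) fun a => by
    rw [RKHS.norm_sum_smul_kerFun_sq hK]
    exact hbound O a.support a
  refine ⟨((16 : ℝ) ^ (H + α) * δ ^ (-(H + α))) • F, fun η => ?_, ?_⟩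
  · rw [RKHS.coe_smul, Pi.smul_apply, hF, smul_eq_mul]
    unfold fDelta
    ring
  · have hδ2 : δ ^ (2 * (H + α)) * (δ ^ (-(H + α))) ^ 2 = 1 := by
      rw [← Real.rpow_natCast, ← Real.rpow_mul hδ.le, ← Real.rpow_add hδ]
      push_cast
      ring_nf
      exact Real.rpow_zero δ
    rw [norm_smul, Real.norm_of_nonneg (by positivity)]
    calc δ ^ (2 * (H + α)) * (16 ^ (H + α) * δ ^ (-(H + α)) * ‖F‖) ^ 2
        = (16 ^ (H + α)) ^ 2 * (δ ^ (2 * (H + α)) * (δ ^ (-(H + α))) ^ 2) * ‖F‖ ^ 2 := by ring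
      _ = (16 ^ (H + α)) ^ 2 * ‖F‖ ^ 2 := by rw [hδ2, mul_one]
      _ ≤ _ := by gcongr
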